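/- Let $N\ge 3$ be an integer, $\alpha\ge 2$ and $\frac{N}{N-2}<p<\infty$. Let $\omega_N$ be the Lebesgue measure of the unit ball of $\mathbb{R}^N$, put $C_N=\frac{1}{N(2-N)\omega_N}$, and for (real- or complex-valued) $f\in L^p(\mathbb{R}^N)$ set $$Tf(x)=C_N\int_{\mathbb{R}^N}\frac{f(y)}{(1+|y|^\alpha)\,|x-y|^{N-2}}\,dy .$$ Then for every $f\in L^p(\mathbb{R}^N)$ the integral converges absolutely for almost every $x\in\mathbb{R}^N$, $T$ is a bounded linear operator on $L^p(\mathbb{R}^N)$, and its operator norm satisfies $$\|T\|_p\le\left(\frac{2}{\alpha-2}\right)^{\frac{2}{\alpha}}\frac{\alpha-2}{\alpha}\;\frac{p^2}{N(Np-N-2p)},$$ where for $\alpha=2$ the factor $\left(\frac{2}{\alpha-2}\right)^{2/\alpha}\frac{\alpha-2}{\alpha}$ is understood as its limit $1$ as $\alpha\to2^+$. -/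

import Mathlib

open MeasureTheory

noncomputable section

/-- The constant `C_N = (N (2 - N) ω_N)⁻¹`, where `ω_N` is the Lebesgue measure of the unit ball
of `ℝ^N`. -/
def newtonConst (N : ℕ) : ℝ :=
  ((N : ℝ) * (2 - (N : ℝ)) *
    (volume : Measure (EuclideanSpace ℝ (Fin N))).real (Metric.ball 0 1))⁻¹

/-- The integrand `f(y) / ((1 + |y|^α) |x - y|^(N-2))`, as a function of `y`. -/
def opTIntegrand {𝕜 : Type*} [RCLike 𝕜] (N : ℕ) (α : ℝ) (f : EuclideanSpace ℝ (Fin N) → 𝕜)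
    (x y : EuclideanSpace ℝ (Fin N)) : 𝕜 :=
  ((1 + ‖y‖ ^ α) * ‖x - y‖ ^ ((N : ℝ) - 2))⁻¹ • f y

/-- `T f(x) = C_N ∫ f(y) / ((1 + |y|^α) |x - y|^(N-2)) dy`. -/
def opT {𝕜 : Type*} [RCLike 𝕜] (N : ℕ) (α : ℝ) (f : EuclideanSpace ℝ (Fin N) → 𝕜)
    (x : EuclideanSpace ℝ (Fin N)) : 𝕜 :=
  newtonConst N • ∫ y, opTIntegrand N α f x y

/-- The factor `(2/(α-2))^(2/α) (α-2)/α` for `α > 2`, extended to `α = 2` by its limit `1`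
as `α` decreases to `2`. -/
def alphaFactor (α : ℝ) : ℝ :=
  if α = 2 then 1 else (2 / (α - 2)) ^ (2 / α) * ((α - 2) / α)

end

open Set

/-! By weighted AM-GM, `1 / (1 + |y|^α) ≤ F |y|⁻²` with `F = alphaFactor α`. Hence `|Tf|` is
dominated by `F` times the integral of `|f|` against `newtonHardyKernel`, which is homogeneous of
degree `-N`; Schur's test with power weights bounds such a kernel on `L^p`.

Both Schur integrals come from one formula, the integrated form of `Δ|x|^(-s) = -s (N-2-s)
|x|^(-s-2)`: after normalization by `|C_N|`, the Newtonian potential of `|y|^(-s-2)` is `|x|^(-s) /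
(s (N-2-s))`. It is proved by writing both powers as superpositions of Gaussians
(`lintegral_norm_rpow_mul_norm_sub_rpow`). The constant is invariant under `s ↦ N-2-s`, so `s = N/p`
and `s = N-2-N/p` give the same value `p² / (N (Np-N-2p))`; `p > N/(N-2)` says exactly that `N/p <
N-2`. -/

/-! ### Gamma and Gaussian integrals -/

/-- The subordination formula `Γ(k) r^(-k) = ∫₀^∞ t^(-k-1) e^(-r/t) dt`. -/
theorem lintegral_rpow_mul_exp_neg_div_Ioi {k r : ℝ} (hk : 0 < k) (hr : 0 < r) :
    ∫⁻ t in Ioi (0 : ℝ), ENNReal.ofReal (t ^ (-k - 1) * Real.exp (-(r / t))) =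
      ENNReal.ofReal (Real.Gamma k * r ^ (-k)) := by
  -- The substitution `u = 1/t` in the Gamma integral.
  have h1 := integral_comp_rpow_Ioi (fun u : ℝ => u ^ (k - 1) * Real.exp (-(r * u)))
    (p := -1) (by norm_num)
  rw [Real.integral_rpow_mul_exp_neg_mul_Ioi hk hr] at h1
  have h2 : ∫ t in Ioi (0 : ℝ), t ^ (-k - 1) * Real.exp (-(r / t)) =
      Real.Gamma k * r ^ (-k) := by
    rw [Real.rpow_neg hr.le, ← Real.inv_rpow hr.le, mul_comm (Real.Gamma k), ← one_div r, ← h1]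
    refine setIntegral_congr_fun measurableSet_Ioi fun t ht => ?_
    have ht' : (0 : ℝ) < t := ht
    simp only [abs_neg, abs_one, one_mul, smul_eq_mul]
    rw [← Real.rpow_mul ht'.le, ← mul_assoc, ← Real.rpow_add ht', Real.rpow_neg_one,
      ← div_eq_mul_inv]
    congr 2
    ring
  have hpos : 0 < Real.Gamma k * r ^ (-k) :=
    mul_pos (Real.Gamma_pos_of_pos hk) (Real.rpow_pos_of_pos hr _)
  rw [← h2, ofReal_integral_eq_lintegral_ofReal]
  -- A non-integrable function has Bochner integral `0`, so a nonzero integral proves integrability.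
  · exact not_imp_comm.1 integral_undef (by rw [h2]; exact hpos.ne')
  · refine (ae_restrict_mem measurableSet_Ioi).mono fun t ht => ?_
    have ht' : (0 : ℝ) < t := ht
    simp only [Pi.zero_apply]
    positivity

theorem lintegral_rpow_Ioo {e u : ℝ} (he : -1 < e) (hu : 0 < u) :
    ∫⁻ t in Ioo 0 u, ENNReal.ofReal (t ^ e) = ENNReal.ofReal (u ^ (e + 1) / (e + 1)) := by
  have h : ∫ t in Ioc 0 u, t ^ e = u ^ (e + 1) / (e + 1) := by
    rw [← intervalIntegral.integral_of_le hu.le, integral_rpow (Or.inl he),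
      Real.zero_rpow (by linarith), sub_zero]
  rw [restrict_Ioo_eq_restrict_Ioc, ← h, ofReal_integral_eq_lintegral_ofReal]
  · exact (intervalIntegrable_iff_integrableOn_Ioc_of_le hu.le).1
      (intervalIntegral.intervalIntegrable_rpow' he)
  · refine (ae_restrict_mem measurableSet_Ioc).mono fun t ht => ?_
    exact Real.rpow_nonneg ht.1.le _

section InnerProductSpace

variable {V : Type*} [NormedAddCommGroup V] [InnerProductSpace ℝ V]

theorem sq_norm_div_add_sq_norm_sub_div {t τ : ℝ} (ht : 0 < t) (hτ : 0 < τ) (x y : V) :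
    ‖y‖ ^ 2 / τ + ‖x - y‖ ^ 2 / t =
      (t + τ) / (t * τ) * ‖y - (τ / (t + τ)) • x‖ ^ 2 + ‖x‖ ^ 2 / (t + τ) := by
  rw [norm_sub_sq_real, norm_sub_sq_real, norm_smul, inner_smul_right, real_inner_comm,
    mul_pow, Real.norm_eq_abs, sq_abs]
  field_simp
  ring

variable [FiniteDimensional ℝ V] [MeasurableSpace V] [BorelSpace V]

theorem lintegral_exp_neg_mul_sq_norm {b : ℝ} (hb : 0 < b) :
    ∫⁻ y : V, ENNReal.ofReal (Real.exp (-b * ‖y‖ ^ 2)) =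
      ENNReal.ofReal ((Real.pi / b) ^ (Module.finrank ℝ V / 2 : ℝ)) := by
  have h := GaussianFourier.integral_rexp_neg_mul_sq_norm (V := V) hb
  rw [← h, ofReal_integral_eq_lintegral_ofReal]
  · exact not_imp_comm.1 integral_undef (by rw [h]; positivity)
  · exact Filter.Eventually.of_forall fun y => (Real.exp_pos _).le

/-- Completing the square in `y` leaves a translated Gaussian, whose integral ignores the centre.
The widths add, so the exponential factor depends on `t + τ` alone. -/
theorem lintegral_gaussian_mul_gaussian {t τ : ℝ} (ht : 0 < t) (hτ : 0 < τ) (x : V) :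
    ∫⁻ y : V, ENNReal.ofReal (Real.exp (-(‖y‖ ^ 2 / τ)) * Real.exp (-(‖x - y‖ ^ 2 / t))) =
      ENNReal.ofReal ((Real.pi * (t * τ / (t + τ))) ^ (Module.finrank ℝ V / 2 : ℝ) *
        Real.exp (-(‖x‖ ^ 2 / (t + τ)))) := by
  have hb : 0 < (t + τ) / (t * τ) := by positivity
  have h1 : ∀ y : V,
      ENNReal.ofReal (Real.exp (-(‖y‖ ^ 2 / τ)) * Real.exp (-(‖x - y‖ ^ 2 / t))) =
      ENNReal.ofReal (Real.exp (-((t + τ) / (t * τ)) * ‖y - (τ / (t + τ)) • x‖ ^ 2)) *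
        ENNReal.ofReal (Real.exp (-(‖x‖ ^ 2 / (t + τ)))) := by
    intro y
    rw [← ENNReal.ofReal_mul (Real.exp_pos _).le, ← Real.exp_add, ← Real.exp_add]
    congr 2
    have := sq_norm_div_add_sq_norm_sub_div ht hτ x y
    linarith
  simp_rw [h1]
  rw [lintegral_mul_const' _ _ ENNReal.ofReal_ne_top,
    lintegral_sub_right_eq_self
      (fun y : V => ENNReal.ofReal (Real.exp (-((t + τ) / (t * τ)) * ‖y‖ ^ 2))),
    lintegral_exp_neg_mul_sq_norm hb, ← ENNReal.ofReal_mul (by positivity)]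
  congr 4
  field_simp

end InnerProductSpace

/-! ### The Newtonian potential of a power -/

/-- Tonelli on the sector `0 < τ < u`, written in the coordinates `(τ, u - τ)`. -/
theorem lintegral_lintegral_mul_comp_add_Ioi {a H : ℝ → ENNReal} (ha : Measurable a)
    (hH : Measurable H) :
    ∫⁻ τ in Ioi (0 : ℝ), ∫⁻ t in Ioi (0 : ℝ), a τ * H (t + τ) =
      ∫⁻ u in Ioi (0 : ℝ), (∫⁻ τ in Ioo 0 u, a τ) * H u := by
  have h1 : ∀ τ, ∫⁻ t in Ioi (0 : ℝ), a τ * H (t + τ) =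
      ∫⁻ u, (Ioi τ).indicator (fun u => a τ * H u) u := by
    intro τ
    rw [← lintegral_indicator measurableSet_Ioi,
      ← lintegral_add_right_eq_self (fun u => (Ioi τ).indicator (fun u => a τ * H u) u) τ]
    refine lintegral_congr fun t => ?_
    by_cases h : 0 < t <;> simp [indicator, h]
  simp_rw [h1]
  have hm : Measurable (Function.uncurry fun τ u : ℝ =>
      (Ioi τ).indicator (fun u => a τ * H u) u) := by
    have : (Function.uncurry fun τ u : ℝ => (Ioi τ).indicator (fun u => a τ * H u) u) =
        {q : ℝ × ℝ | q.1 < q.2}.indicator (fun q => a q.1 * H q.2) := by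
      ext ⟨τ, u⟩
      simp [indicator]
    rw [this]
    exact ((ha.comp measurable_fst).mul (hH.comp measurable_snd)).indicator
      (measurableSet_lt measurable_fst measurable_snd)
  rw [lintegral_lintegral_swap hm.aemeasurable, ← lintegral_indicator measurableSet_Ioi]
  refine lintegral_congr fun u => ?_
  have h2 : ∀ τ ∈ Ioi (0 : ℝ), (Ioi τ).indicator (fun u => a τ * H u) u =
      (Iio u).indicator (fun τ => a τ * H u) τ := by
    intro τ _
    simp [indicator]
  rw [setLIntegral_congr_fun measurableSet_Ioi h2, setLIntegral_indicator measurableSet_Iio,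
    inter_comm, Ioi_inter_Iio, lintegral_mul_const _ ha]
  by_cases hu : 0 < u
  · rw [indicator_of_mem (show u ∈ Ioi 0 from hu)]
  · rw [indicator_of_notMem (show u ∉ Ioi 0 from hu), Ioo_eq_empty hu]
    simp

/-- The Newtonian potential of a power of the norm:
`∫ |y|^(-s-2) |x-y|^(2-d) dy = 4 π^(d/2) / Γ(d/2-1) · |x|^(-s) / (s (d-2-s))`. -/
theorem lintegral_norm_rpow_mul_norm_sub_rpow {V : Type*} [NormedAddCommGroup V]
    [InnerProductSpace ℝ V] [FiniteDimensional ℝ V] [MeasurableSpace V] [BorelSpace V]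
    {d s : ℝ} (hd : (Module.finrank ℝ V : ℝ) = d) (hs : 0 < s) (hsd : s < d - 2)
    {x : V} (hx : x ≠ 0) :
    ∫⁻ y : V, ENNReal.ofReal (‖y‖ ^ (-s - 2) * ‖x - y‖ ^ (2 - d)) =
      ENNReal.ofReal (4 * Real.pi ^ (d / 2) / Real.Gamma (d / 2 - 1) / (s * (d - 2 - s)) *
        ‖x‖ ^ (-s)) := by
  have hk1 : 0 < s / 2 + 1 := by linarith
  have hk2 : 0 < d / 2 - 1 := by linarith
  have hG1 := Real.Gamma_pos_of_pos hk1
  have hG2 := Real.Gamma_pos_of_pos hk2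
  have : Nontrivial V := ⟨x, 0, hx⟩
  -- both powers as superpositions of Gaussians
  have key : ∀ᵐ y : V, ENNReal.ofReal (Real.Gamma (s / 2 + 1) * Real.Gamma (d / 2 - 1)) *
      ENNReal.ofReal (‖y‖ ^ (-s - 2) * ‖x - y‖ ^ (2 - d)) =
      ∫⁻ τ in Ioi (0 : ℝ), ∫⁻ t in Ioi (0 : ℝ),
        ENNReal.ofReal (τ ^ (-(s / 2 + 1) - 1) * Real.exp (-(‖y‖ ^ 2 / τ))) *
        ENNReal.ofReal (t ^ (-(d / 2 - 1) - 1) * Real.exp (-(‖x - y‖ ^ 2 / t))) := by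
    -- Subordination needs `|y|` and `|x - y|` positive.
    have e0 : ∀ᵐ y : V, y ≠ 0 := Measure.ae_ne volume 0
    have e1 : ∀ᵐ y : V, y ≠ x := Measure.ae_ne volume x
    filter_upwards [e0, e1] with y hy hyx
    have hy' : 0 < ‖y‖ := norm_pos_iff.2 hy
    have hyx' : 0 < ‖x - y‖ := norm_pos_iff.2 (sub_ne_zero.2 hyx.symm)
    simp_rw [lintegral_const_mul' _ _ ENNReal.ofReal_ne_top]
    rw [lintegral_mul_const' _ _ (by
        rw [lintegral_rpow_mul_exp_neg_div_Ioi hk2 (by positivity)]; exact ENNReal.ofReal_ne_top),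
      lintegral_rpow_mul_exp_neg_div_Ioi hk2 (by positivity),
      lintegral_rpow_mul_exp_neg_div_Ioi hk1 (by positivity),
      ← ENNReal.ofReal_mul (by positivity), ← ENNReal.ofReal_mul (by positivity),
      ← Real.rpow_natCast, ← Real.rpow_natCast, ← Real.rpow_mul hy'.le, ← Real.rpow_mul hyx'.le]
    congr 1
    have h1 : ((2 : ℕ) : ℝ) * -(s / 2 + 1) = -s - 2 := by push_cast; ring
    have h2 : ((2 : ℕ) : ℝ) * -(d / 2 - 1) = 2 - d := by push_cast; ring
    rw [h1, h2]
    ring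
  have hmain : ENNReal.ofReal (Real.Gamma (s / 2 + 1) * Real.Gamma (d / 2 - 1)) *
      ∫⁻ y : V, ENNReal.ofReal (‖y‖ ^ (-s - 2) * ‖x - y‖ ^ (2 - d)) =
      ENNReal.ofReal (Real.pi ^ (d / 2) / ((d - s) / 2 - 1) *
        (Real.Gamma (s / 2) * ‖x‖ ^ (-s))) := by
    rw [← lintegral_const_mul' _ _ ENNReal.ofReal_ne_top, lintegral_congr_ae key,
      lintegral_lintegral_swap]
    swap
    · refine Measurable.aemeasurable ?_
      refine Measurable.lintegral_prod_right' (ν := volume.restrict (Ioi (0 : ℝ)))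
        (f := fun q : (V × ℝ) × ℝ =>
          ENNReal.ofReal (q.1.2 ^ (-(s / 2 + 1) - 1) * Real.exp (-(‖q.1.1‖ ^ 2 / q.1.2))) *
          ENNReal.ofReal (q.2 ^ (-(d / 2 - 1) - 1) * Real.exp (-(‖x - q.1.1‖ ^ 2 / q.2)))) ?_
      fun_prop
    have inner : ∀ τ ∈ Ioi (0 : ℝ), (∫⁻ y : V, ∫⁻ t in Ioi (0 : ℝ),
        ENNReal.ofReal (τ ^ (-(s / 2 + 1) - 1) * Real.exp (-(‖y‖ ^ 2 / τ))) *
        ENNReal.ofReal (t ^ (-(d / 2 - 1) - 1) * Real.exp (-(‖x - y‖ ^ 2 / t)))) =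
        ∫⁻ t in Ioi (0 : ℝ), ENNReal.ofReal (τ ^ ((d - s) / 2 - 2)) *
          (fun u => ENNReal.ofReal (Real.pi ^ (d / 2) * u ^ (-(d / 2)) *
            Real.exp (-(‖x‖ ^ 2 / u)))) (t + τ) := by
      intro τ hτ
      have hτ' : (0 : ℝ) < τ := hτ
      rw [lintegral_lintegral_swap (by refine Measurable.aemeasurable ?_; fun_prop)]
      refine setLIntegral_congr_fun measurableSet_Ioi fun t ht => ?_
      have ht' : (0 : ℝ) < t := ht
      have h1 : ∀ y : V,
          ENNReal.ofReal (τ ^ (-(s / 2 + 1) - 1) * Real.exp (-(‖y‖ ^ 2 / τ))) *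
          ENNReal.ofReal (t ^ (-(d / 2 - 1) - 1) * Real.exp (-(‖x - y‖ ^ 2 / t))) =
          ENNReal.ofReal (τ ^ (-(s / 2 + 1) - 1) * t ^ (-(d / 2 - 1) - 1)) *
          ENNReal.ofReal (Real.exp (-(‖y‖ ^ 2 / τ)) * Real.exp (-(‖x - y‖ ^ 2 / t))) := by
        intro y
        rw [← ENNReal.ofReal_mul (by positivity), ← ENNReal.ofReal_mul (by positivity)]
        congr 1
        ring
      simp_rw [h1]
      rw [lintegral_const_mul' _ _ ENNReal.ofReal_ne_top,
        lintegral_gaussian_mul_gaussian ht' hτ' x, hd,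
        ← ENNReal.ofReal_mul (by positivity), ← ENNReal.ofReal_mul (by positivity)]
      congr 1
      rw [Real.mul_rpow Real.pi_pos.le (by positivity), Real.div_rpow (by positivity)
        (by positivity), Real.mul_rpow ht'.le hτ'.le, Real.rpow_neg (by positivity : 0 ≤ t + τ)]
      have e1 : τ ^ ((d - s) / 2 - 2) = τ ^ (-(s / 2 + 1) - 1) * τ ^ (d / 2) := by
        rw [← Real.rpow_add hτ']; congr 1; ring
      -- Special to the Newtonian exponent: the powers of `t` cancel, so apart from a power of `τ`
      -- only `u = t + τ` remains.
      have e2 : t ^ (-(d / 2 - 1) - 1) * t ^ (d / 2) = 1 := by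
        rw [← Real.rpow_add ht', ← Real.rpow_zero t]; congr 1; ring
      rw [e1]
      calc _ = (t ^ (-(d / 2 - 1) - 1) * t ^ (d / 2)) * (τ ^ (-(s / 2 + 1) - 1) * τ ^ (d / 2) *
            (Real.pi ^ (d / 2) * ((t + τ) ^ (d / 2))⁻¹ * Real.exp (-(‖x‖ ^ 2 / (t + τ))))) := by
              ring
        _ = _ := by rw [e2, one_mul]
    -- The `τ`-integral converges at `0` because `s < d - 2`; what remains is the subordination
    -- integral with `k = s/2`.
    have hint : ∀ u ∈ Ioi (0 : ℝ), (∫⁻ τ in Ioo 0 u, ENNReal.ofReal (τ ^ ((d - s) / 2 - 2))) *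
        ENNReal.ofReal (Real.pi ^ (d / 2) * u ^ (-(d / 2)) * Real.exp (-(‖x‖ ^ 2 / u))) =
        ENNReal.ofReal (Real.pi ^ (d / 2) / ((d - s) / 2 - 1)) *
          ENNReal.ofReal (u ^ (-(s / 2) - 1) * Real.exp (-(‖x‖ ^ 2 / u))) := by
      intro u hu
      have hu' : (0 : ℝ) < u := hu
      have hc : 0 < (d - s) / 2 - 1 := by linarith
      have e0 : (d - s) / 2 - 2 + 1 = (d - s) / 2 - 1 := by ring
      rw [lintegral_rpow_Ioo (by linarith) hu', e0, ← ENNReal.ofReal_mul (by positivity),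
        ← ENNReal.ofReal_mul (by positivity)]
      congr 1
      have e1 : u ^ (-(s / 2) - 1) = u ^ ((d - s) / 2 - 1) * u ^ (-(d / 2)) := by
        rw [← Real.rpow_add hu']; congr 1; ring
      rw [e1]
      ring
    rw [setLIntegral_congr_fun measurableSet_Ioi inner,
      lintegral_lintegral_mul_comp_add_Ioi (a := fun τ => ENNReal.ofReal (τ ^ ((d - s) / 2 - 2)))
        (H := fun u => ENNReal.ofReal (Real.pi ^ (d / 2) * u ^ (-(d / 2)) *
          Real.exp (-(‖x‖ ^ 2 / u))))
        (by fun_prop) (by fun_prop),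
      setLIntegral_congr_fun measurableSet_Ioi hint,
      lintegral_const_mul' _ _ ENNReal.ofReal_ne_top]
    have hx' : 0 < ‖x‖ := norm_pos_iff.2 hx
    have hc : 0 < (d - s) / 2 - 1 := by linarith
    rw [lintegral_rpow_mul_exp_neg_div_Ioi (by positivity) (by positivity),
      ← ENNReal.ofReal_mul (by positivity), ← Real.rpow_natCast, ← Real.rpow_mul hx'.le]
    congr 4
    push_cast
    ring
  have hne : ENNReal.ofReal (Real.Gamma (s / 2 + 1) * Real.Gamma (d / 2 - 1)) ≠ 0 := by
    rw [Ne, ENNReal.ofReal_eq_zero, not_le]; positivity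
  rw [← ENNReal.mul_right_inj hne ENNReal.ofReal_ne_top, hmain,
    ← ENNReal.ofReal_mul (by positivity)]
  congr 1
  rw [Real.Gamma_add_one (by positivity)]
  have hc : d - 2 - s ≠ 0 := by linarith
  have hc2 : (d - s) / 2 - 1 = (d - 2 - s) / 2 := by ring
  rw [hc2]
  generalize Real.Gamma (d / 2 - 1) = G at *
  field_simp
  ring

/-! ### Schur's test -/

/-- Schur's test: a nonnegative kernel with the weights `h`, `k` is bounded by `A` on `L^p`. -/
theorem lintegral_rpow_lintegral_kernel_le {X Y : Type*} [MeasurableSpace X] [MeasurableSpace Y]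
    {μ : Measure X} {ν : Measure Y} [SFinite μ] [SFinite ν] {p q : ℝ} (hpq : p.HolderConjugate q)
    {K : X → Y → ENNReal} (hK : Measurable (Function.uncurry K)) {k : X → ENNReal}
    (hk : Measurable k) {h : Y → ENNReal} (hh : Measurable h) (h0 : ∀ᵐ y ∂ν, h y ≠ 0)
    (h1 : ∀ᵐ y ∂ν, h y ≠ ⊤) {A : ENNReal} (hA : A ≠ ⊤)
    (hx : ∀ᵐ x ∂μ, ∫⁻ y, K x y * h y ^ q ∂ν ≤ A * k x ^ q)
    (hy : ∀ᵐ y ∂ν, ∫⁻ x, K x y * k x ^ p ∂μ ≤ A * h y ^ p)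
    {g : Y → ENNReal} (hg : AEMeasurable g ν) :
    ∫⁻ x, (∫⁻ y, K x y * g y ∂ν) ^ p ∂μ ≤ A ^ p * ∫⁻ y, g y ^ p ∂ν := by
  wlog hgm : Measurable g generalizing g
  · have := this hg.measurable_mk.aemeasurable hg.measurable_mk
    have e1 : ∀ x, ∫⁻ y, K x y * g y ∂ν = ∫⁻ y, K x y * hg.mk g y ∂ν := fun x =>
      lintegral_congr_ae (hg.ae_eq_mk.mono fun y hy => by simp only [hy])
    have e2 : ∫⁻ y, g y ^ p ∂ν = ∫⁻ y, hg.mk g y ^ p ∂ν :=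
      lintegral_congr_ae (hg.ae_eq_mk.mono fun y hy => by simp only [hy])
    simpa only [e1, e2] using this
  have hp := hpq.pos
  have hq := hpq.symm.pos
  have hKx : ∀ x, Measurable (K x) := fun x => hK.of_uncurry_left
  have hKy : ∀ y, Measurable (fun x => K x y) := fun y => hK.of_uncurry_right
  have step : ∀ᵐ x ∂μ, (∫⁻ y, K x y * g y ∂ν) ^ p ≤
      A ^ (p / q) * ∫⁻ y, k x ^ p * (K x y * (g y * (h y)⁻¹) ^ p) ∂ν := by
    filter_upwards [hx] with x hx
    have hKx' := hKx x
    -- Splitting for Hölder: `K g = (K^(1/p) g h⁻¹) (K^(1/q) h)`. Cancelling `h⁻¹ h` needs `h`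
    -- nonzero and finite.
    have e : ∫⁻ y, K x y * g y ∂ν = ∫⁻ y, ((fun y => K x y ^ (1 / p) * (g y * (h y)⁻¹)) *
        (fun y => K x y ^ (1 / q) * h y)) y ∂ν := by
      refine lintegral_congr_ae ?_
      filter_upwards [h0, h1] with y hy0 hy1
      have e1 : K x y = K x y ^ (1 / p) * K x y ^ (1 / q) := by
        rw [← ENNReal.rpow_add_of_nonneg _ _ (by positivity) (by positivity), one_div, one_div,
          hpq.inv_add_inv_eq_one, ENNReal.rpow_one]
      simp only [Pi.mul_apply]
      calc K x y * g y = (K x y ^ (1 / p) * K x y ^ (1 / q)) * (g y * ((h y)⁻¹ * h y)) := by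
            rw [← e1, ENNReal.inv_mul_cancel hy0 hy1, mul_one]
        _ = _ := by ring
    have hold := ENNReal.lintegral_mul_le_Lp_mul_Lq ν hpq
      (f := fun y => K x y ^ (1 / p) * (g y * (h y)⁻¹)) (g := fun y => K x y ^ (1 / q) * h y)
      (by fun_prop) (by fun_prop)
    rw [← e] at hold
    have r : ∀ {r : ℝ}, 0 < r → ∀ a b : ENNReal, (a ^ (1 / r) * b) ^ r = a * b ^ r := by
      intro r hr a b
      rw [ENNReal.mul_rpow_of_nonneg _ _ hr.le, ← ENNReal.rpow_mul, one_div_mul_cancel hr.ne',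
        ENNReal.rpow_one]
    simp_rw [r hp, r hq] at hold
    calc (∫⁻ y, K x y * g y ∂ν) ^ p
        ≤ ((∫⁻ y, K x y * (g y * (h y)⁻¹) ^ p ∂ν) ^ (1 / p) * (A * k x ^ q) ^ (1 / q)) ^ p := by
          refine ENNReal.rpow_le_rpow (hold.trans ?_) hp.le
          gcongr
      _ = A ^ (p / q) * (k x ^ p * ∫⁻ y, K x y * (g y * (h y)⁻¹) ^ p ∂ν) := by
          rw [r hp, ENNReal.mul_rpow_of_nonneg _ _ (by positivity), ← ENNReal.rpow_mul,
            mul_one_div_cancel hq.ne', ENNReal.rpow_one, ENNReal.mul_rpow_of_nonneg _ _ hp.le,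
            ← ENNReal.rpow_mul, one_div_mul_eq_div]
          ring
      _ = _ := by rw [lintegral_const_mul]; fun_prop
  have hApq : A ^ (p / q) ≠ ⊤ := ENNReal.rpow_ne_top_of_nonneg (by positivity) hA
  calc ∫⁻ x, (∫⁻ y, K x y * g y ∂ν) ^ p ∂μ
      ≤ ∫⁻ x, A ^ (p / q) * ∫⁻ y, k x ^ p * (K x y * (g y * (h y)⁻¹) ^ p) ∂ν ∂μ :=
        lintegral_mono_ae step
    _ = A ^ (p / q) * ∫⁻ y, ∫⁻ x, k x ^ p * (K x y * (g y * (h y)⁻¹) ^ p) ∂μ ∂ν := by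
        rw [lintegral_const_mul' _ _ hApq, lintegral_lintegral_swap]
        refine Measurable.aemeasurable ?_
        exact ((hk.comp measurable_fst).pow_const p).mul (hK.mul
          (((hgm.comp measurable_snd).mul (hh.comp measurable_snd).inv).pow_const p))
    _ = A ^ (p / q) * ∫⁻ y, (g y * (h y)⁻¹) ^ p * ∫⁻ x, K x y * k x ^ p ∂μ ∂ν := by
        congr 1
        refine lintegral_congr fun y => ?_
        have := hKy y
        rw [← lintegral_const_mul _ (by fun_prop)]
        refine lintegral_congr fun x => ?_
        ring
    _ ≤ A ^ (p / q) * ∫⁻ y, A * g y ^ p ∂ν := by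
        gcongr A ^ (p / q) * ?_
        refine lintegral_mono_ae ?_
        filter_upwards [hy, h0, h1] with y hy hy0 hy1
        calc (g y * (h y)⁻¹) ^ p * ∫⁻ x, K x y * k x ^ p ∂μ
            ≤ (g y * (h y)⁻¹) ^ p * (A * h y ^ p) := by gcongr
          _ = A * (g y * ((h y)⁻¹ * h y)) ^ p := by
            rw [← mul_assoc (g y), ENNReal.mul_rpow_of_nonneg _ (h y) hp.le]
            ring
          _ = A * g y ^ p := by rw [ENNReal.inv_mul_cancel hy0 hy1, mul_one]
    _ = A ^ p * ∫⁻ y, g y ^ p ∂ν := by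
        rw [lintegral_const_mul' _ _ hA, ← mul_assoc]
        congr 1
        nth_rw 2 [← ENNReal.rpow_one A]
        rw [← ENNReal.rpow_add_of_nonneg _ _ (by positivity) zero_le_one]
        congr 1
        rw [hpq.div_conj_eq_sub_one]
        ring

/-! ### The constants -/

/-- The supremum of `r² / (1 + r^α)` is at most `alphaFactor α`. -/
theorem sq_le_alphaFactor_mul {α r : ℝ} (hα : 2 ≤ α) (hr : 0 ≤ r) :
    r ^ 2 ≤ alphaFactor α * (1 + r ^ α) := by
  unfold alphaFactor
  split_ifs with h
  · subst h
    rw [Real.rpow_two]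
    linarith
  · have hα' : 0 < α - 2 := sub_pos.2 (lt_of_le_of_ne hα (Ne.symm h))
    have h0 : 0 < α := by linarith
    set v : ℝ := (α - 2) / α with hv
    set w : ℝ := 2 / α with hw
    have hv0 : 0 < v := by positivity
    have hw0 : 0 < w := by positivity
    have hvw : v + w = 1 := by rw [hv, hw]; field_simp; ring
    have hq : 2 / (α - 2) = w / v := by rw [hv, hw]; field_simp
    have hra : 0 ≤ r ^ α := Real.rpow_nonneg hr _
    -- The points are chosen so that the weighted mean is `1 + r^α`; the geometric mean is `r² /
    -- (v^v w^w)`, and `alphaFactor α = w^w v^v`.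
    have am := Real.geom_mean_le_arith_mean2_weighted hv0.le hw0.le (p₁ := 1 / v)
      (p₂ := r ^ α / w) (by positivity) (by positivity) hvw
    have e1 : v * (1 / v) + w * (r ^ α / w) = 1 + r ^ α := by field_simp
    have e2 : (r ^ α) ^ w = r ^ 2 := by
      rw [← Real.rpow_mul hr, hw, mul_div_cancel₀ _ h0.ne', Real.rpow_two]
    have e3 : v = v ^ v * v ^ w := by rw [← Real.rpow_add hv0, hvw, Real.rpow_one]
    rw [e1, Real.div_rpow hra hw0.le, Real.div_rpow zero_le_one hv0.le, Real.one_rpow, e2] at am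
    have e4 : (2 / (α - 2)) ^ w * v = w ^ w * v ^ v := by
      rw [hq, Real.div_rpow hw0.le hv0.le]
      nth_rw 2 [e3]
      field_simp
    rw [e4]
    calc r ^ 2 = w ^ w * v ^ v * (1 / v ^ v * (r ^ 2 / w ^ w)) := by field_simp
      _ ≤ _ := by gcongr

theorem alphaFactor_nonneg {α : ℝ} (hα : 2 ≤ α) : 0 ≤ alphaFactor α := by
  simpa using (zero_le_one.trans (by simpa using sq_le_alphaFactor_mul hα zero_le_one) :
    (0 : ℝ) ≤ alphaFactor α * (1 + 1))

/-- `C_N` exactly normalizes the potential formula, since `ω_N = π^(N/2) / Γ(N/2+1)` and `Γ(N/2+1) =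
(N/2)(N/2-1) Γ(N/2-1)`. -/
theorem abs_newtonConst_mul {N : ℕ} (hN : 3 ≤ N) :
    |newtonConst N| *
      (4 * Real.pi ^ ((N : ℝ) / 2) / Real.Gamma ((N : ℝ) / 2 - 1)) = 1 := by
  have hN' : (3 : ℝ) ≤ N := by exact_mod_cast hN
  have : Nonempty (Fin N) := ⟨⟨0, by omega⟩⟩
  have hG := Real.Gamma_pos_of_pos (show 0 < (N : ℝ) / 2 - 1 by linarith)
  have hG' : Real.Gamma ((N : ℝ) / 2 + 1) =
      (N : ℝ) / 2 * (((N : ℝ) / 2 - 1) * Real.Gamma ((N : ℝ) / 2 - 1)) := by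
    have h : (N : ℝ) / 2 - 1 ≠ 0 := by linarith
    rw [Real.Gamma_add_one (by positivity), ← Real.Gamma_add_one h, sub_add_cancel]
  have hpi : √Real.pi ^ N = Real.pi ^ ((N : ℝ) / 2) := by
    rw [Real.sqrt_eq_rpow, ← Real.rpow_natCast, ← Real.rpow_mul Real.pi_pos.le]
    congr 1
    ring
  have hb : (volume : Measure (EuclideanSpace ℝ (Fin N))).real (Metric.ball 0 1) =
      Real.pi ^ ((N : ℝ) / 2) / Real.Gamma ((N : ℝ) / 2 + 1) := by
    have hG0 : 0 < Real.Gamma ((N : ℝ) / 2 + 1) := Real.Gamma_pos_of_pos (by positivity)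
    rw [Measure.real, EuclideanSpace.volume_ball, Fintype.card_fin, hpi, ENNReal.ofReal_one,
      one_pow, one_mul, ENNReal.toReal_ofReal (by positivity)]
  have h2 : (N : ℝ) - 2 ≠ 0 := by linarith
  have habs : |newtonConst N| = ((N : ℝ) * ((N : ℝ) - 2) *
      (Real.pi ^ ((N : ℝ) / 2) / Real.Gamma ((N : ℝ) / 2 + 1)))⁻¹ := by
    have hG0 : 0 < Real.Gamma ((N : ℝ) / 2 + 1) := Real.Gamma_pos_of_pos (by positivity)
    rw [newtonConst, hb, abs_inv, abs_mul, abs_mul, abs_of_nonneg (by positivity : (0 : ℝ) ≤ N),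
      abs_sub_comm, abs_of_nonneg (by linarith : (0 : ℝ) ≤ (N : ℝ) - 2),
      abs_of_nonneg (by positivity)]
  have e : (N : ℝ) / 2 - 1 = (N - 2) / 2 := by ring
  rw [habs, hG']
  generalize Real.Gamma ((N : ℝ) / 2 - 1) = G at *
  rw [e]
  field_simp
  norm_num

/-! ### The homogeneous kernel on `L^p` -/

/-- The kernel `|C_N| |y|⁻² |x - y|^(2-N)`, homogeneous of degree `-N`. -/
noncomputable def newtonHardyKernel (N : ℕ) (x y : EuclideanSpace ℝ (Fin N)) : ENNReal :=
  ENNReal.ofReal (|newtonConst N| * (‖y‖ ^ (-2 : ℝ) * ‖x - y‖ ^ (2 - (N : ℝ))))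

theorem measurable_newtonHardyKernel (N : ℕ) :
    Measurable (Function.uncurry (newtonHardyKernel N)) := by
  unfold newtonHardyKernel Function.uncurry
  fun_prop

/-- Normalized form of the potential of a power of the norm. -/
theorem lintegral_newtonConst_mul_norm_rpow {N : ℕ} (hN : 3 ≤ N) {s : ℝ} (hs : 0 < s)
    (hsN : s < N - 2) {x : EuclideanSpace ℝ (Fin N)} (hx : x ≠ 0) :
    ∫⁻ y : EuclideanSpace ℝ (Fin N),
      ENNReal.ofReal (|newtonConst N| * (‖y‖ ^ (-s - 2) * ‖x - y‖ ^ (2 - (N : ℝ)))) =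
      ENNReal.ofReal ((s * (N - 2 - s))⁻¹ * ‖x‖ ^ (-s)) := by
  simp_rw [ENNReal.ofReal_mul (abs_nonneg (newtonConst N))]
  rw [lintegral_const_mul' _ _ ENNReal.ofReal_ne_top,
    lintegral_norm_rpow_mul_norm_sub_rpow (by simp) hs hsN hx,
    ← ENNReal.ofReal_mul (abs_nonneg _)]
  congr 1
  calc _ = |newtonConst N| * (4 * Real.pi ^ ((N : ℝ) / 2) / Real.Gamma ((N : ℝ) / 2 - 1)) *
        ((s * (N - 2 - s))⁻¹ * ‖x‖ ^ (-s)) := by ring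
    _ = _ := by rw [abs_newtonConst_mul hN, one_mul]

theorem lintegral_rpow_newtonHardyKernel_le {N : ℕ} (hN : 3 ≤ N) {p : ℝ}
    (hp : (N : ℝ) / ((N : ℝ) - 2) < p) {g : EuclideanSpace ℝ (Fin N) → ENNReal}
    (hg : AEMeasurable g) :
    ∫⁻ x, (∫⁻ y, newtonHardyKernel N x y * g y) ^ p ≤
      ENNReal.ofReal (p ^ 2 / ((N : ℝ) * ((N : ℝ) * p - (N : ℝ) - 2 * p))) ^ p *
        ∫⁻ y, g y ^ p := by
  have hN' : (3 : ℝ) ≤ N := by exact_mod_cast hN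
  have hN2 : 0 < (N : ℝ) - 2 := by linarith
  have : Nonempty (Fin N) := ⟨⟨0, by omega⟩⟩
  have hp1 : 1 < p := lt_trans ((one_lt_div hN2).2 (by linarith)) hp
  have hp0 : 0 < p := by linarith
  have hpN : (N : ℝ) < p * (N - 2) := (div_lt_iff₀ hN2).1 hp
  have hpq := Real.HolderConjugate.conjExponent hp1
  set q := p.conjExponent
  have hq0 : 0 < q := hpq.symm.pos
  have hs : 0 < (N : ℝ) / p := by positivity
  have hsN : (N : ℝ) / p < N - 2 := by rw [div_lt_iff₀ hp0]; linarith
  have hA : p ^ 2 / ((N : ℝ) * ((N : ℝ) * p - (N : ℝ) - 2 * p)) =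
      ((N : ℝ) / p * (N - 2 - N / p))⁻¹ := by
    have h1 : (N : ℝ) * p - N - 2 * p ≠ 0 := by nlinarith
    have h2 : (N : ℝ) - 2 - N / p ≠ 0 := by linarith
    have h3 : (N : ℝ) * p - N - 2 * p = p * (N - 2 - N / p) := by field_simp; ring
    rw [h3]
    generalize (N : ℝ) - 2 - N / p = c at *
    field_simp
  have hA' : 0 < (N : ℝ) / p * (N - 2 - N / p) := mul_pos hs (by linarith)
  -- The weight `|x|^(-b)` has `bq = N/p` and `bp = N/q = (N-2-N/p) + 2`, so the two Schur integrals
  -- are potentials with `s = N/p` and `s = N-2-N/p`.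
  set b : ℝ := N / p / q with hb
  have hbq : -b * q = -(N / p) := by rw [hb]; field_simp
  have hbp : -b * p = -(N - 2 - N / p) - 2 := by
    have h1 : b * p = N / q := by rw [hb]; field_simp
    have h2 : (N : ℝ) / q = N * (1 - 1 / p) := by
      rw [one_div, hpq.one_sub_inv, div_eq_mul_inv]
    rw [neg_mul, h1, h2]
    ring
  have hw : ∀ {r : ℝ}, 0 ≤ r → ∀ y : EuclideanSpace ℝ (Fin N),
      ENNReal.ofReal (‖y‖ ^ (-b)) ^ r = ENNReal.ofReal (‖y‖ ^ (-b * r)) := by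
    intro r hr y
    rw [ENNReal.ofReal_rpow_of_nonneg (by positivity) hr, Real.rpow_mul (norm_nonneg y)]
  have hae : ∀ᵐ y : EuclideanSpace ℝ (Fin N), y ≠ 0 := Measure.ae_ne volume 0
  refine lintegral_rpow_lintegral_kernel_le hpq (measurable_newtonHardyKernel N)
    (k := fun x => ENNReal.ofReal (‖x‖ ^ (-b))) (by fun_prop)
    (h := fun x => ENNReal.ofReal (‖x‖ ^ (-b))) (by fun_prop) ?_ ?_ ENNReal.ofReal_ne_top
    ?_ ?_ hg
  · filter_upwards [hae] with y hy
    rw [Ne, ENNReal.ofReal_eq_zero, not_le]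
    exact Real.rpow_pos_of_pos (norm_pos_iff.2 hy) _
  · exact Filter.Eventually.of_forall fun y => ENNReal.ofReal_ne_top
  · filter_upwards [hae] with x hx
    simp_rw [hw hq0.le]
    rw [hbq, hA, ← ENNReal.ofReal_mul (by positivity),
      ← lintegral_newtonConst_mul_norm_rpow hN hs hsN hx]
    refine (lintegral_congr_ae ?_).le
    filter_upwards [hae] with y hy
    rw [newtonHardyKernel, ← ENNReal.ofReal_mul (by positivity), sub_eq_add_neg (-((N : ℝ) / p)),
      Real.rpow_add (norm_pos_iff.2 hy)]
    congr 1
    ring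
  · filter_upwards [hae] with y hy
    simp_rw [hw hp0.le]
    have h1 : ∀ x : EuclideanSpace ℝ (Fin N),
        newtonHardyKernel N x y * ENNReal.ofReal (‖x‖ ^ (-b * p)) =
        ENNReal.ofReal (‖y‖ ^ (-2 : ℝ)) * ENNReal.ofReal (|newtonConst N| *
          (‖x‖ ^ (-(N - 2 - N / p) - 2 : ℝ) * ‖y - x‖ ^ (2 - (N : ℝ)))) := by
      intro x
      rw [newtonHardyKernel, ← ENNReal.ofReal_mul (by positivity),
        ← ENNReal.ofReal_mul (by positivity), norm_sub_rev, hbp]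
      congr 1
      ring
    simp_rw [h1]
    rw [lintegral_const_mul' _ _ ENNReal.ofReal_ne_top,
      lintegral_newtonConst_mul_norm_rpow hN (by linarith) (by linarith) hy, hA,
      ← ENNReal.ofReal_mul (by positivity), ← ENNReal.ofReal_mul (by positivity), hbp,
      sub_eq_add_neg (-((N : ℝ) - 2 - N / p)), Real.rpow_add (norm_pos_iff.2 hy)]
    refine le_of_eq ?_
    congr 1
    have e : (N : ℝ) - 2 - (N - 2 - N / p) = N / p := by ring
    rw [e]
    ring

/-! ### The operator `T` -/

section Operator

variable {𝕜 : Type*} [RCLike 𝕜] {N : ℕ} {α : ℝ} {f : EuclideanSpace ℝ (Fin N) → 𝕜}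

theorem enorm_newtonConst_mul_lintegral_le (hN : 3 ≤ N) (hα : 2 ≤ α)
    (f : EuclideanSpace ℝ (Fin N) → 𝕜) (x : EuclideanSpace ℝ (Fin N)) :
    ‖newtonConst N‖ₑ * ∫⁻ y, ‖opTIntegrand N α f x y‖ₑ ≤
      ENNReal.ofReal (alphaFactor α) * ∫⁻ y, newtonHardyKernel N x y * ‖f y‖ₑ := by
  have : Nonempty (Fin N) := ⟨⟨0, by omega⟩⟩
  rw [← lintegral_const_mul' _ _ enorm_ne_top, ← lintegral_const_mul' _ _ ENNReal.ofReal_ne_top]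
  -- The origin must be excluded: there `‖y‖ ^ (-2)` takes the default value `0` and the pointwise
  -- bound fails.
  have hae : ∀ᵐ y : EuclideanSpace ℝ (Fin N), y ≠ 0 := Measure.ae_ne volume 0
  refine lintegral_mono_ae ?_
  filter_upwards [hae] with y hy
  have hy' : 0 < ‖y‖ := norm_pos_iff.2 hy
  have hF := alphaFactor_nonneg hα
  rw [opTIntegrand, enorm_smul, newtonHardyKernel, ← mul_assoc, ← mul_assoc]
  refine mul_le_mul_left ?_ _
  rw [Real.enorm_eq_ofReal_abs, Real.enorm_eq_ofReal (by positivity),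
    ← ENNReal.ofReal_mul (abs_nonneg _), ← ENNReal.ofReal_mul hF]
  refine ENNReal.ofReal_le_ofReal ?_
  have e : ‖x - y‖ ^ (2 - (N : ℝ)) = (‖x - y‖ ^ ((N : ℝ) - 2))⁻¹ := by
    rw [← Real.rpow_neg (norm_nonneg _), neg_sub]
  have e' : (1 + ‖y‖ ^ α)⁻¹ ≤ alphaFactor α * ‖y‖ ^ (-2 : ℝ) := by
    rw [Real.rpow_neg hy'.le, Real.rpow_two, ← div_eq_mul_inv, inv_eq_one_div,
      div_le_div_iff₀ (by positivity) (by positivity), one_mul]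
    exact sq_le_alphaFactor_mul hα hy'.le
  rw [e, mul_inv]
  calc |newtonConst N| * ((1 + ‖y‖ ^ α)⁻¹ * (‖x - y‖ ^ ((N : ℝ) - 2))⁻¹)
      ≤ |newtonConst N| *
        (alphaFactor α * ‖y‖ ^ (-2 : ℝ) * (‖x - y‖ ^ ((N : ℝ) - 2))⁻¹) := by gcongr
    _ = _ := by ring

/-- With the norm kept inside the integral, one estimate yields both a.e. absolute convergence and
the norm bound. -/
theorem lintegral_rpow_enorm_newtonConst_mul_le (hN : 3 ≤ N) (hα : 2 ≤ α) {p : ℝ}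
    (hp : (N : ℝ) / ((N : ℝ) - 2) < p) (hf : AEStronglyMeasurable f) :
    ∫⁻ x, (‖newtonConst N‖ₑ * ∫⁻ y, ‖opTIntegrand N α f x y‖ₑ) ^ p ≤
      ENNReal.ofReal (alphaFactor α *
        (p ^ 2 / ((N : ℝ) * ((N : ℝ) * p - (N : ℝ) - 2 * p)))) ^ p * ∫⁻ y, ‖f y‖ₑ ^ p := by
  have hN2 : 0 < (N : ℝ) - 2 := by
    have : (3 : ℝ) ≤ N := by exact_mod_cast hN
    linarith
  have hp0 : 0 ≤ p := (div_nonneg (Nat.cast_nonneg N) hN2.le).trans hp.le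
  have hF : ENNReal.ofReal (alphaFactor α) ^ p ≠ ⊤ :=
    ENNReal.rpow_ne_top_of_nonneg hp0 ENNReal.ofReal_ne_top
  calc _ ≤ ∫⁻ x, ENNReal.ofReal (alphaFactor α) ^ p *
        (∫⁻ y, newtonHardyKernel N x y * ‖f y‖ₑ) ^ p := by
        refine lintegral_mono fun x => ?_
        rw [← ENNReal.mul_rpow_of_nonneg _ _ hp0]
        exact ENNReal.rpow_le_rpow (enorm_newtonConst_mul_lintegral_le hN hα f x) hp0
    _ ≤ _ := by
        rw [lintegral_const_mul' _ _ hF, ENNReal.ofReal_mul (alphaFactor_nonneg hα),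
          ENNReal.mul_rpow_of_nonneg _ _ hp0, mul_assoc]
        gcongr
        exact lintegral_rpow_newtonHardyKernel_le hN hp hf.enorm

theorem aestronglyMeasurable_uncurry_opTIntegrand (hf : AEStronglyMeasurable f) :
    AEStronglyMeasurable (Function.uncurry (opTIntegrand N α f)) (volume.prod volume) := by
  have h : Measurable fun z : EuclideanSpace ℝ (Fin N) × EuclideanSpace ℝ (Fin N) =>
      ((1 + ‖z.2‖ ^ α) * ‖z.1 - z.2‖ ^ ((N : ℝ) - 2))⁻¹ := by fun_prop
  exact h.aestronglyMeasurable.smul hf.comp_snd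

theorem aestronglyMeasurable_opTIntegrand (hf : AEStronglyMeasurable f)
    (x : EuclideanSpace ℝ (Fin N)) : AEStronglyMeasurable (opTIntegrand N α f x) := by
  have h : Measurable fun y : EuclideanSpace ℝ (Fin N) =>
      ((1 + ‖y‖ ^ α) * ‖x - y‖ ^ ((N : ℝ) - 2))⁻¹ := by fun_prop
  exact h.aestronglyMeasurable.smul hf

theorem aestronglyMeasurable_opT (hf : AEStronglyMeasurable f) :
    AEStronglyMeasurable (opT N α f) :=
  (aestronglyMeasurable_uncurry_opTIntegrand hf).integral_prod_right'.const_smul _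

theorem ae_integrable_opTIntegrand (hN : 3 ≤ N) (hα : 2 ≤ α) {p : ℝ}
    (hp : (N : ℝ) / ((N : ℝ) - 2) < p) (hf : MemLp f (ENNReal.ofReal p)) :
    ∀ᵐ x, Integrable (opTIntegrand N α f x) := by
  have hN2 : 0 < (N : ℝ) - 2 := by
    have : (3 : ℝ) ≤ N := by exact_mod_cast hN
    linarith
  have hp0 : 0 < p := (div_nonneg (Nat.cast_nonneg N) hN2.le).trans_lt hp
  have hC : newtonConst N ≠ 0 := by
    intro h
    have := abs_newtonConst_mul hN
    simp [h] at this
  have hfin : ∫⁻ y, ‖f y‖ₑ ^ p < ⊤ := by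
    have := lintegral_rpow_enorm_lt_top_of_eLpNorm_lt_top (by simpa using hp0)
      ENNReal.ofReal_ne_top hf.2
    rwa [ENNReal.toReal_ofReal hp0.le] at this
  have hmeas : AEMeasurable fun x => ∫⁻ y, ‖opTIntegrand N α f x y‖ₑ :=
    (aestronglyMeasurable_uncurry_opTIntegrand hf.1).enorm.lintegral_prod_right'
  have hlt := (lintegral_rpow_enorm_newtonConst_mul_le hN hα hp hf.1).trans_lt
    (ENNReal.mul_lt_top (ENNReal.rpow_lt_top_of_nonneg hp0.le ENNReal.ofReal_ne_top) hfin)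
  filter_upwards [ae_lt_top' ((hmeas.const_mul _).pow_const p) hlt.ne] with x hx
  refine ⟨aestronglyMeasurable_opTIntegrand hf.1 x, ?_⟩
  rw [ENNReal.rpow_lt_top_iff_of_pos hp0] at hx
  exact ENNReal.lt_top_of_mul_ne_top_right hx.ne (enorm_ne_zero.2 hC)

theorem eLpNorm_opT_le (hN : 3 ≤ N) (hα : 2 ≤ α) {p : ℝ} (hp : (N : ℝ) / ((N : ℝ) - 2) < p)
    (hf : AEStronglyMeasurable f) :
    eLpNorm (opT N α f) (ENNReal.ofReal p) volume ≤
      ENNReal.ofReal (alphaFactor α * (p ^ 2 / ((N : ℝ) * ((N : ℝ) * p - (N : ℝ) - 2 * p)))) *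
        eLpNorm f (ENNReal.ofReal p) volume := by
  have hN2 : 0 < (N : ℝ) - 2 := by
    have : (3 : ℝ) ≤ N := by exact_mod_cast hN
    linarith
  have hp0 : 0 < p := (div_nonneg (Nat.cast_nonneg N) hN2.le).trans_lt hp
  have hp0' : ENNReal.ofReal p ≠ 0 := by simpa using hp0
  rw [eLpNorm_eq_lintegral_rpow_enorm_toReal hp0' ENNReal.ofReal_ne_top,
    eLpNorm_eq_lintegral_rpow_enorm_toReal hp0' ENNReal.ofReal_ne_top,
    ENNReal.toReal_ofReal hp0.le]
  have h : ∫⁻ x, ‖opT N α f x‖ₑ ^ p ≤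
      ∫⁻ x, (‖newtonConst N‖ₑ * ∫⁻ y, ‖opTIntegrand N α f x y‖ₑ) ^ p := by
    refine lintegral_mono fun x => ENNReal.rpow_le_rpow ?_ hp0.le
    rw [opT, enorm_smul]
    gcongr
    -- Valid without integrability, where the Bochner integral is `0`.
    exact enorm_integral_le_lintegral_enorm _
  refine (ENNReal.rpow_le_rpow (h.trans (lintegral_rpow_enorm_newtonConst_mul_le hN hα hp hf))
    (by positivity)).trans_eq ?_
  rw [ENNReal.mul_rpow_of_nonneg _ _ (by positivity), ← ENNReal.rpow_mul,
    mul_one_div_cancel hp0.ne', ENNReal.rpow_one]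

theorem memLp_opT (hN : 3 ≤ N) (hα : 2 ≤ α) {p : ℝ} (hp : (N : ℝ) / ((N : ℝ) - 2) < p)
    (hf : MemLp f (ENNReal.ofReal p)) : MemLp (opT N α f) (ENNReal.ofReal p) :=
  ⟨aestronglyMeasurable_opT hf.1, (eLpNorm_opT_le hN hα hp hf.1).trans_lt
    (ENNReal.mul_lt_top ENNReal.ofReal_lt_top hf.2)⟩

/-- Equality holds at every `x`, so representatives of sums and multiples in `Lp` can be exchanged
before evaluation. -/
theorem opT_congr_ae {g : EuclideanSpace ℝ (Fin N) → 𝕜} (h : f =ᵐ[volume] g) :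
    opT N α f = opT N α g := by
  funext x
  refine congrArg _ (integral_congr_ae (h.mono fun y hy => ?_))
  simp only [opTIntegrand, hy]

theorem opT_add_apply {g : EuclideanSpace ℝ (Fin N) → 𝕜} {x : EuclideanSpace ℝ (Fin N)}
    (hf : Integrable (opTIntegrand N α f x)) (hg : Integrable (opTIntegrand N α g x)) :
    opT N α (f + g) x = opT N α f x + opT N α g x := by
  rw [opT, opT, opT, ← smul_add, ← integral_add hf hg]
  simp only [opTIntegrand, Pi.add_apply, smul_add]

theorem opT_const_smul (c : 𝕜) (f : EuclideanSpace ℝ (Fin N) → 𝕜) :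
    opT N α (c • f) = c • opT N α f := by
  funext x
  rw [Pi.smul_apply, opT, opT, smul_comm c, ← integral_smul c]
  simp only [opTIntegrand, Pi.smul_apply, smul_comm c]

end Operator

theorem mainTheorem11 {𝕜 : Type*} [RCLike 𝕜] (N : ℕ) (hN : 3 ≤ N) (α : ℝ) (hα : 2 ≤ α)
    (p : ℝ) (hp : (N : ℝ) / ((N : ℝ) - 2) < p) [Fact (1 ≤ ENNReal.ofReal p)] :
    (∀ f : EuclideanSpace ℝ (Fin N) → 𝕜, MemLp f (ENNReal.ofReal p) volume →
      ∀ᵐ x, Integrable (opTIntegrand N α f x) volume) ∧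
    ∃ T : Lp 𝕜 (ENNReal.ofReal p) (volume : Measure (EuclideanSpace ℝ (Fin N))) →L[𝕜]
        Lp 𝕜 (ENNReal.ofReal p) (volume : Measure (EuclideanSpace ℝ (Fin N))),
      (∀ f, T f =ᵐ[volume] opT N α f) ∧
      ‖T‖ ≤ alphaFactor α * ((p ^ 2) / ((N : ℝ) * ((N : ℝ) * p - (N : ℝ) - 2 * p))) := by
  refine ⟨fun f hf => ae_integrable_opTIntegrand hN hα hp hf, ?_⟩
  have hB : 0 ≤ alphaFactor α * ((p ^ 2) / ((N : ℝ) * ((N : ℝ) * p - (N : ℝ) - 2 * p))) := by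
    have hN' : (3 : ℝ) ≤ N := by exact_mod_cast hN
    have hpN : (N : ℝ) < p * (N - 2) := (div_lt_iff₀ (by linarith)).1 hp
    have h : 0 ≤ (N : ℝ) * p - N - 2 * p := by linarith
    have := alphaFactor_nonneg hα
    positivity
  let T : Lp 𝕜 (ENNReal.ofReal p) (volume : Measure (EuclideanSpace ℝ (Fin N))) →ₗ[𝕜]
      Lp 𝕜 (ENNReal.ofReal p) (volume : Measure (EuclideanSpace ℝ (Fin N))) :=
    { toFun := fun f => (memLp_opT hN hα hp (Lp.memLp f)).toLp (opT N α f)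
      map_add' := fun f g => by
        rw [← MemLp.toLp_add, MemLp.toLp_eq_toLp_iff, opT_congr_ae (Lp.coeFn_add f g)]
        filter_upwards [ae_integrable_opTIntegrand hN hα hp (Lp.memLp f),
          ae_integrable_opTIntegrand hN hα hp (Lp.memLp g)] with x hf hg
        exact opT_add_apply hf hg
      map_smul' := fun c f => by
        rw [RingHom.id_apply, ← MemLp.toLp_const_smul, MemLp.toLp_eq_toLp_iff,
          opT_congr_ae (Lp.coeFn_smul c f), opT_const_smul] }
  refine ⟨T.mkContinuous _ fun f => ?_, fun f => ?_, T.mkContinuous_norm_le hB _⟩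
  · change ‖(memLp_opT hN hα hp (Lp.memLp f)).toLp (opT N α f)‖ ≤ _
    rw [Lp.norm_toLp, Lp.norm_def, ← ENNReal.toReal_ofReal hB, ← ENNReal.toReal_mul]
    exact ENNReal.toReal_mono (ENNReal.mul_ne_top ENNReal.ofReal_ne_top (Lp.eLpNorm_ne_top f))
      (eLpNorm_opT_le hN hα hp (Lp.aestronglyMeasurable f))
  · exact (memLp_opT hN hα hp (Lp.memLp f)).coeFn_toLp
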